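/- Let $E$ be a truncated Riesz space, that is, a real Riesz space with a map $x\mapsto\bar x$ from $E^+$ to $E^+$ such that, for all $a,b\in E^+$: $(\tau_1)$ $a\wedge\bar b\le\bar a\le a$; $(\tau_2)$ $\bar a=0$ implies $a=0$. The truncation satisfies $(\tau_3)$ if $a\in E^+$ and $\overline{na}=na$ for all $n\in\mathbb N$ imply $a=0$; $E$ is unital if there is $u\in E^+$ with $\bar x=x\wedge u$ for all $x\in E^+$. Let $\bar E=\{x\in E:\overline{|x|}=|x|\}$, and let $E\oplus\mathbb R=\{x+\lambda:x\in E,\lambda\in\mathbb R\}$ be the Riesz space with positive cone $$(E\oplus\mathbb R)^+=E^+\cup\{x+\lambda:\ 0<\lambda\in\mathbb R,\ x\in E,\ \tfrac1\lambda x^-\in\bar E\}.$$ A Riesz space is called universally complete if it is Dedekind complete (every nonempty subset that is bounded above has a supremum) and laterally complete (every nonempty family of pairwise disjoint positive elements has a supremum). Then: (1) If $E$ is universally complete, then $E\oplus\mathbb R$ is universally complete if and only if the truncation on $E$ satisfies $(\tau_3)$. (2) If $E\oplus\mathbb R$ is universally complete, then $E$ is universally complete if and only if $E$ is unital. -/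

import Mathlib

/-- A truncation on a Riesz space `E`: a map `x ↦ x̄` of the positive cone `E⁺` into itself
satisfying `(τ₁)` and `(τ₂)`. It is given by a function on all of `E`, of which only the values
on `E⁺` are ever used. -/
structure Truncation (E : Type*) [AddCommGroup E] [Lattice E] where
  toFun : E → E
  map_nonneg : ∀ a, 0 ≤ a → 0 ≤ toFun a
  /-- `(τ₁)`, first half -/
  inf_le : ∀ a b, 0 ≤ a → 0 ≤ b → a ⊓ toFun b ≤ toFun a
  /-- `(τ₁)`, second half -/
  le_self : ∀ a, 0 ≤ a → toFun a ≤ a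
  /-- `(τ₂)` -/
  eq_zero : ∀ a, 0 ≤ a → toFun a = 0 → a = 0

/-- Dedekind completeness: nonempty subsets that are bounded above have a supremum. -/
def IsDedekindComplete (E : Type*) [Lattice E] : Prop :=
  ∀ s : Set E, s.Nonempty → BddAbove s → ∃ a, IsLUB s a

/-- Lateral completeness: every nonempty set of pairwise disjoint positive elements (bounded
above or not) has a supremum. -/
def IsLaterallyComplete (E : Type*) [AddCommGroup E] [Lattice E] : Prop :=
  ∀ s : Set E, s.Nonempty → (∀ x ∈ s, 0 ≤ x) → (s.Pairwise fun x y => x ⊓ y = 0) →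
    ∃ a, IsLUB s a

/-- Universal completeness: Dedekind completeness together with lateral completeness. -/
def IsUniversallyComplete (E : Type*) [AddCommGroup E] [Lattice E] : Prop :=
  IsDedekindComplete E ∧ IsLaterallyComplete E

namespace Truncation

variable {E : Type*} [AddCommGroup E] [Lattice E]

/-- Condition `(τ₃)`: if the truncation fixes all multiples `n x` of `x ∈ E⁺`, then `x = 0`. -/
def IsArchimedean (T : Truncation E) : Prop :=
  ∀ x : E, 0 ≤ x → (∀ n : ℕ, T.toFun (n • x) = n • x) → x = 0

/-- The truncation is unital: it is the meet with some `u ∈ E⁺`. -/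
def IsUnital (T : Truncation E) : Prop :=
  ∃ u : E, 0 ≤ u ∧ ∀ x : E, 0 ≤ x → T.toFun x = x ⊓ u

/-- The set `Ē` of fixed points of the truncation. -/
def fixedPoints (T : Truncation E) : Set E := {x | T.toFun |x| = |x|}

/-- The underlying space of the unitization `E ⊕ ℝ`; the pair `(x, r)` stands for `x + r`. -/
def Unitization (_T : Truncation E) : Type _ := E × ℝ

namespace Unitization

instance (T : Truncation E) : AddCommGroup T.Unitization :=
  inferInstanceAs (AddCommGroup (E × ℝ))

instance [Module ℝ E] (T : Truncation E) : Module ℝ T.Unitization :=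
  inferInstanceAs (Module ℝ (E × ℝ))

/-- The positive cone of `E ⊕ ℝ`, that is
`E⁺ ∪ {x + r : 0 < r, x ∈ E, (1 / r) x⁻ ∈ Ē}`. -/
def IsPos [Module ℝ E] {T : Truncation E} (p : T.Unitization) : Prop :=
  (p.2 = 0 ∧ 0 ≤ p.1) ∨ (0 < p.2 ∧ (p.2)⁻¹ • (p.1)⁻ ∈ T.fixedPoints)

end Unitization

/-! ### The unitization is a Riesz space -/

variable (T : Truncation E)

theorem map_of_le [IsOrderedAddMonoid E] {a w : E} (ha : 0 ≤ a) (haw : a ≤ w)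
    (hw : T.toFun w = w) : T.toFun a = a := by
  refine le_antisymm (T.le_self a ha) ?_
  have := T.inf_le a w ha (ha.trans haw)
  rwa [hw, inf_eq_left.2 haw] at this

theorem map_sup {a b : E} (ha : 0 ≤ a) (hb : 0 ≤ b) (hTa : T.toFun a = a)
    (hTb : T.toFun b = b) : T.toFun (a ⊔ b) = a ⊔ b := by
  have hab : 0 ≤ a ⊔ b := ha.trans le_sup_left
  refine le_antisymm (T.le_self _ hab) (sup_le ?_ ?_)
  · have := T.inf_le (a ⊔ b) a hab ha
    rwa [hTa, inf_eq_right.2 le_sup_left] at this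
  · have := T.inf_le (a ⊔ b) b hab hb
    rwa [hTb, inf_eq_right.2 le_sup_right] at this

theorem map_zero : T.toFun 0 = 0 :=
  le_antisymm (T.le_self 0 le_rfl) (T.map_nonneg 0 le_rfl)

theorem map_map {a : E} (ha : 0 ≤ a) : T.toFun (T.toFun a) = T.toFun a := by
  refine le_antisymm (T.le_self _ (T.map_nonneg a ha)) ?_
  have := T.inf_le (T.toFun a) a (T.map_nonneg a ha) ha
  rwa [inf_idem] at this

namespace Unitization

variable [IsOrderedAddMonoid E] [Module ℝ E] [IsOrderedModule ℝ E] {T}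

/-- `x + r` is positive iff `0 ≤ r` and `0 ≤ x + r w` for some positive fixed point `w`. -/
theorem isPos_iff (p : T.Unitization) :
    p.IsPos ↔ 0 ≤ p.2 ∧ ∃ w : E, 0 ≤ w ∧ T.toFun w = w ∧ 0 ≤ p.1 + p.2 • w := by
  constructor
  · rintro (⟨h, h0⟩ | ⟨h, hw⟩)
    · exact ⟨h.ge, 0, le_rfl, T.map_zero, by simpa using h0⟩
    · have h0 : 0 ≤ (p.2)⁻¹ • (p.1)⁻ := smul_nonneg (inv_nonneg.2 h.le) (negPart_nonneg _)
      refine ⟨h.le, _, h0, ?_, ?_⟩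
      · simpa only [fixedPoints, Set.mem_ofPred_eq, abs_of_nonneg h0] using hw
      · rw [smul_inv_smul₀ h.ne']
        have := posPart_sub_negPart p.1
        rw [sub_eq_iff_eq_add] at this
        rw [← this]
        exact posPart_nonneg _
  · rintro ⟨h, w, hw, hTw, hx⟩
    rcases h.eq_or_lt with h | h
    · exact Or.inl ⟨h.symm, by simpa [← h] using hx⟩
    · refine Or.inr ⟨h, ?_⟩
      have h0 : 0 ≤ (p.2)⁻¹ • (p.1)⁻ := smul_nonneg (inv_nonneg.2 h.le) (negPart_nonneg _)
      have hle : (p.1)⁻ ≤ p.2 • w :=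
        sup_le (neg_le_iff_add_nonneg'.2 hx) (smul_nonneg h.le hw)
      simp only [fixedPoints, Set.mem_ofPred_eq, abs_of_nonneg h0]
      refine T.map_of_le h0 ?_ hTw
      have := smul_le_smul_of_nonneg_left hle (inv_nonneg.2 h.le)
      rwa [inv_smul_smul₀ h.ne'] at this

theorem isPos_add {p q : T.Unitization} (hp : p.IsPos) (hq : q.IsPos) : (p + q).IsPos := by
  rw [isPos_iff] at *
  obtain ⟨hp2, w, hw, hTw, hpw⟩ := hp
  obtain ⟨hq2, v, hv, hTv, hqv⟩ := hq
  refine ⟨add_nonneg hp2 hq2, w ⊔ v, hw.trans le_sup_left, T.map_sup hw hv hTw hTv, ?_⟩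
  have h1 := smul_le_smul_of_nonneg_left (le_sup_left : w ≤ w ⊔ v) hp2
  have h2 := smul_le_smul_of_nonneg_left (le_sup_right : v ≤ w ⊔ v) hq2
  calc (0 : E) ≤ (p.1 + p.2 • w) + (q.1 + q.2 • v) := add_nonneg hpw hqv
    _ ≤ (p.1 + p.2 • (w ⊔ v)) + (q.1 + q.2 • (w ⊔ v)) := by gcongr
    _ = (p.1 + q.1) + (p.2 + q.2) • (w ⊔ v) := by rw [add_smul]; abel

theorem eq_zero_of_isPos {p : T.Unitization} (hp : p.IsPos) (hn : (-p).IsPos) : p = 0 := by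
  rw [isPos_iff] at *
  obtain ⟨hp2, w, -, -, hpw⟩ := hp
  obtain ⟨hn2, v, -, -, hnv⟩ := hn
  change 0 ≤ -p.2 at hn2
  change 0 ≤ -p.1 + (-p.2) • v at hnv
  have h2 : p.2 = 0 := by linarith
  rw [h2, zero_smul, add_zero] at hpw
  rw [h2, neg_zero, zero_smul, add_zero] at hnv
  exact Prod.ext (le_antisymm (neg_nonneg.1 hnv) hpw) h2

theorem isPos_zero : (0 : T.Unitization).IsPos := Or.inl ⟨rfl, le_rfl⟩

/-- The order of `E ⊕ ℝ` given by its positive cone. -/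
instance : PartialOrder T.Unitization where
  le p q := (q - p).IsPos
  le_refl p := by
    change (p - p).IsPos
    rw [sub_self]; exact isPos_zero
  le_trans p q r h1 h2 := by
    have := isPos_add h2 h1
    rwa [sub_add_sub_cancel] at this
  le_antisymm p q h1 h2 := by
    have h3 : (-(q - p)).IsPos := by rw [neg_sub]; exact h2
    exact (sub_eq_zero.1 (eq_zero_of_isPos h1 h3)).symm

theorem le_iff (p q : T.Unitization) : p ≤ q ↔ (q - p).IsPos := Iff.rfl

instance : IsOrderedAddMonoid T.Unitization where
  add_le_add_left p q h r := by
    rw [le_iff] at *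
    rwa [add_sub_add_right_eq_sub]

/-- The element `x⁺ - r t + r`, `t` the truncation of `(1 / r) x⁻`, is the positive part of
`x + r` if `0 < r`. -/
theorem exists_isLUB_of_pos (p : T.Unitization) (h : 0 < p.2) :
    IsLUB {p, 0} (((p.1)⁺ - p.2 • T.toFun ((p.2)⁻¹ • (p.1)⁻), p.2) : E × ℝ) := by
  obtain ⟨x, r⟩ := p
  change 0 < r at h
  have h0 : 0 ≤ r⁻¹ • x⁻ := smul_nonneg (inv_nonneg.2 h.le) (negPart_nonneg _)
  set t := T.toFun (r⁻¹ • x⁻) with ht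
  have ht0 : 0 ≤ t := T.map_nonneg _ h0
  have hTt : T.toFun t = t := T.map_map h0
  have hrt : r • t ≤ x⁻ := by
    have := smul_le_smul_of_nonneg_left (T.le_self _ h0) h.le
    rwa [smul_inv_smul₀ h.ne'] at this
  constructor
  · rintro q (rfl | rfl)
    · refine (isPos_iff _).2 ⟨(sub_self r).ge, 0, le_rfl, T.map_zero, ?_⟩
      change 0 ≤ x⁺ - r • t - x + (r - r) • (0 : E)
      rw [smul_zero, add_zero]
      have : x⁺ - r • t - x = x⁻ - r • t := by
        conv_lhs => rw [← posPart_sub_negPart x]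
        rw [posPart_sub_negPart]
        nth_rewrite 2 [← posPart_sub_negPart x]
        abel
      rw [this]
      exact sub_nonneg.2 hrt
    · refine (isPos_iff _).2 ⟨?_, t, ht0, hTt, ?_⟩
      · change 0 ≤ r - 0
        simp [h.le]
      · change 0 ≤ x⁺ - r • t - 0 + (r - 0) • t
        simpa using posPart_nonneg x
  · rintro ⟨y, m⟩ hq
    obtain ⟨hm, w, hw, hTw, h1⟩ := (isPos_iff _).1 (hq (Set.mem_insert _ _))
    obtain ⟨-, v, hv, hTv, h2⟩ :=
      (isPos_iff _).1 (hq (Set.mem_insert_of_mem _ (Set.mem_singleton _)))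
    change 0 ≤ m - r at hm
    change 0 ≤ y - x + (m - r) • w at h1
    change 0 ≤ y - 0 + (m - 0) • v at h2
    rw [sub_zero, sub_zero] at h2
    have hs : 0 ≤ w ⊔ v := hw.trans le_sup_left
    have hTs := T.map_sup hw hv hTw hTv
    refine (isPos_iff _).2 ⟨hm, w ⊔ v, hs, hTs, ?_⟩
    change 0 ≤ y - (x⁺ - r • t) + (m - r) • (w ⊔ v)
    have hx : x ≤ y + (m - r) • (w ⊔ v) := by
      have := smul_le_smul_of_nonneg_left (le_sup_left : w ≤ w ⊔ v) hm
      calc x ≤ x + (y - x + (m - r) • w) := le_add_of_nonneg_right h1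
        _ = y + (m - r) • w := by abel
        _ ≤ _ := by gcongr
    have hn : -(r • (w ⊔ v)) ≤ y + (m - r) • (w ⊔ v) := by
      have := smul_le_smul_of_nonneg_left (le_sup_right : v ≤ w ⊔ v) (by linarith : 0 ≤ m)
      rw [sub_smul, neg_le_iff_add_nonneg]
      calc (0 : E) ≤ y + m • v := h2
        _ ≤ y + m • (w ⊔ v) := by gcongr
        _ = _ := by abel
    have hmin : x⁻ ⊓ r • (w ⊔ v) ≤ r • t := by
      have h3 := T.inf_le (r⁻¹ • x⁻) (w ⊔ v) h0 hs
      rw [hTs] at h3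
      have h4 : r⁻¹ • (x⁻ ⊓ r • (w ⊔ v)) ≤ t := by
        refine le_trans (le_inf ?_ ?_) h3
        · exact smul_le_smul_of_nonneg_left inf_le_left (inv_nonneg.2 h.le)
        · have := smul_le_smul_of_nonneg_left
            (inf_le_right : x⁻ ⊓ r • (w ⊔ v) ≤ r • (w ⊔ v)) (inv_nonneg.2 h.le)
          rwa [inv_smul_smul₀ h.ne'] at this
      have := smul_le_smul_of_nonneg_left h4 h.le
      rwa [smul_inv_smul₀ h.ne'] at this
    have hkey : x⁺ - r • t ≤ x ⊔ -(r • (w ⊔ v)) := by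
      set s := r • (w ⊔ v) with hsdef
      have hs0 : 0 ≤ s := smul_nonneg h.le hs
      have h5 : x⁺ - x⁻ ⊓ s = x ⊔ (x⁺ - s) := by
        rw [sub_eq_add_neg, neg_inf, add_sup, ← sub_eq_add_neg, posPart_sub_negPart,
          ← sub_eq_add_neg]
      have h6 : x⁺ - s ≤ x ⊔ -s := by
        rw [posPart_def, sub_eq_add_neg, sup_add]
        refine sup_le (le_sup_of_le_left ?_) (le_sup_of_le_right ?_)
        · simpa using hs0
        · simp
      calc x⁺ - r • t ≤ x⁺ - x⁻ ⊓ s := by gcongr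
        _ = x ⊔ (x⁺ - s) := h5
        _ ≤ x ⊔ -s := sup_le le_sup_left h6
    have := hkey.trans (sup_le hx hn)
    have h7 := sub_nonneg.2 this
    calc (0 : E) ≤ _ := h7
      _ = _ := by abel

theorem exists_isLUB (p : T.Unitization) : ∃ a, IsLUB {p, 0} a := by
  rcases lt_trichotomy p.2 0 with h | h | h
  · obtain ⟨a, ha⟩ : ∃ a, IsLUB {-p, 0} a :=
      ⟨_, exists_isLUB_of_pos (-p) (by change 0 < -p.2; linarith)⟩
    refine ⟨p + a, ?_, ?_⟩
    · rintro q (rfl | rfl)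
      · exact le_add_of_nonneg_right (ha.1 (by simp))
      · exact neg_le_iff_add_nonneg'.1 (ha.1 (Set.mem_insert _ _))
    · intro b hb
      rw [← le_sub_iff_add_le']
      refine ha.2 ?_
      rintro q (rfl | rfl)
      · rw [le_sub_iff_add_le', add_neg_cancel]
        exact hb (by simp)
      · rw [sub_nonneg]
        exact hb (by simp)
  · refine ⟨(((p.1)⁺, 0) : E × ℝ), ?_, ?_⟩
    · rintro q (rfl | rfl)
      · refine Or.inl ⟨?_, ?_⟩
        · change 0 - q.2 = 0
          rw [h, sub_zero]
        · exact sub_nonneg.2 (le_posPart q.1)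
      · exact Or.inl ⟨sub_zero 0, sub_nonneg.2 (posPart_nonneg p.1)⟩
    · rintro ⟨y, m⟩ hq
      obtain ⟨x, r⟩ := p
      obtain rfl : r = 0 := h
      obtain ⟨hm, w, hw, hTw, h1⟩ := (isPos_iff _).1 (hq (Set.mem_insert _ _))
      obtain ⟨-, v, hv, hTv, h2⟩ :=
        (isPos_iff _).1 (hq (Set.mem_insert_of_mem _ (Set.mem_singleton _)))
      change 0 ≤ m - 0 at hm
      change 0 ≤ y - x + (m - 0) • w at h1
      change 0 ≤ y - 0 + (m - 0) • v at h2
      rw [sub_zero] at hm h1 h2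
      rw [sub_zero] at h2
      refine (isPos_iff _).2 ⟨hm.trans_eq (sub_zero m).symm, w ⊔ v, hw.trans le_sup_left,
        T.map_sup hw hv hTw hTv, ?_⟩
      change 0 ≤ y - x⁺ + (m - 0) • (w ⊔ v)
      rw [sub_zero]
      have h3 := smul_le_smul_of_nonneg_left (le_sup_left : w ≤ w ⊔ v) hm
      have h4 := smul_le_smul_of_nonneg_left (le_sup_right : v ≤ w ⊔ v) hm
      have h5 : x⁺ ≤ y + m • (w ⊔ v) := by
        refine sup_le ?_ ?_
        · calc x ≤ x + (y - x + m • w) := le_add_of_nonneg_right h1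
            _ = y + m • w := by abel
            _ ≤ _ := by gcongr
        · exact h2.trans (by gcongr)
      calc (0 : E) ≤ _ := sub_nonneg.2 h5
        _ = _ := by abel
  · exact ⟨_, exists_isLUB_of_pos p h⟩

theorem exists_isLUB_pair (p q : T.Unitization) : ∃ a, IsLUB {p, q} a := by
  obtain ⟨a, ha⟩ := exists_isLUB (p - q)
  refine ⟨a + q, ?_, ?_⟩
  · rintro c (rfl | rfl)
    · exact sub_le_iff_le_add.1 (ha.1 (by simp))
    · exact le_add_of_nonneg_left (ha.1 (by simp))
  · intro b hb
    rw [← le_sub_iff_add_le]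
    refine ha.2 ?_
    rintro c (rfl | rfl)
    · exact sub_le_sub_right (hb (by simp)) q
    · rw [sub_nonneg]
      exact hb (by simp)

/-- The lattice operations of `E ⊕ ℝ`: those of the order given by the positive cone. -/
noncomputable instance : Lattice T.Unitization where
  sup p q := (exists_isLUB_pair p q).choose
  le_sup_left p q := (exists_isLUB_pair p q).choose_spec.1 (by simp)
  le_sup_right p q := (exists_isLUB_pair p q).choose_spec.1 (by simp)
  sup_le p q r hp hq := (exists_isLUB_pair p q).choose_spec.2 (by
    rintro c (rfl | rfl)
    · exact hp
    · exact hq)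
  inf p q := -(exists_isLUB_pair (-p) (-q)).choose
  inf_le_left p q := neg_le.1 ((exists_isLUB_pair (-p) (-q)).choose_spec.1 (by simp))
  inf_le_right p q := neg_le.1 ((exists_isLUB_pair (-p) (-q)).choose_spec.1 (by simp))
  le_inf r p q hp hq := le_neg.1 ((exists_isLUB_pair (-p) (-q)).choose_spec.2 (by
    rintro c (rfl | rfl)
    · exact neg_le_neg hp
    · exact neg_le_neg hq))

theorem isPos_smul {c : ℝ} (hc : 0 ≤ c) {p : T.Unitization} (hp : p.IsPos) :
    (c • p).IsPos := by
  rw [isPos_iff] at *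
  obtain ⟨hp2, w, hw, hTw, h⟩ := hp
  refine ⟨mul_nonneg hc hp2, w, hw, hTw, ?_⟩
  change 0 ≤ c • p.1 + (c * p.2) • w
  rw [mul_smul, ← smul_add]
  exact smul_nonneg hc h

instance : IsOrderedModule ℝ T.Unitization where
  smul_le_smul_of_nonneg_left c hc p q h := by
    rw [le_iff] at *
    change (c • q - c • p).IsPos
    rw [← smul_sub]
    exact isPos_smul hc h
  smul_le_smul_of_nonneg_right p hp c d h := by
    rw [le_iff] at *
    rw [sub_zero] at hp
    change (d • p - c • p).IsPos
    rw [← sub_smul]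
    exact isPos_smul (sub_nonneg.2 h) hp

end Unitization

end Truncation

/-! If `u` is a unit of the truncation, then `x + r ↦ (x + r u, r)` is an order isomorphism of `E ⊕
ℝ` onto `E × ℝ`. Since `ℝ` is universally complete, `E ⊕ ℝ` is then universally complete exactly
when `E` is. Two facts reduce both equivalences to this case.

First, Dedekind completeness of `E ⊕ ℝ` forces `(τ₃)`: if all `n x` are fixed, they lie below `1`,
and a supremum of the multiples of `x` forces `x = 0`.

Second, if `E` is universally complete and `(τ₃)` holds, the supremum of the positive fixed points
is a unit. The difficulty is that they are bounded (`bddAbove_fixedPoints`). For `y > 0` some `n y`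
differs from its truncation `t`, and by `(τ₁)` every fixed point stays below `t` on the support of
`n y - t`. Lateral completeness glues these local bounds into a global one
(`IsUniversallyComplete.bddAbove`). -/

section LatticeGroup

/-! ### Disjointness, bands and gluing of local bounds -/

variable {E : Type*} [AddCommGroup E] [Lattice E] [IsOrderedAddMonoid E]

theorem add_inf_le_of_nonneg {a b c : E} (ha : 0 ≤ a) (hb : 0 ≤ b) (hc : 0 ≤ c) :
    (a + b) ⊓ c ≤ a ⊓ c + b ⊓ c := by
  have h1 : (a + b) ⊓ c ≤ a + b ⊓ c := by
    rw [add_inf]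
    exact inf_le_inf_left _ (le_add_of_nonneg_left ha)
  have h2 : (a + b) ⊓ c ≤ c + b ⊓ c :=
    inf_le_right.trans (le_add_of_nonneg_right (le_inf hb hc))
  rw [inf_add]
  exact le_inf h1 h2

theorem nsmul_inf_eq_zero {a b : E} (ha : 0 ≤ a) (hb : 0 ≤ b) (h : a ⊓ b = 0) (n : ℕ) :
    (n • a) ⊓ b = 0 := by
  induction n with
  | zero => simpa using hb
  | succ n ih =>
    refine le_antisymm ?_ (le_inf (nsmul_nonneg ha _) hb)
    rw [succ_nsmul]
    exact (add_inf_le_of_nonneg (nsmul_nonneg ha n) ha hb).trans (by rw [ih, h, add_zero])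

/-- Disjointness from `c` passes to suprema. -/
theorem IsLUB.inf_eq_zero {s : Set E} {a c : E} (ha : IsLUB s a) (ha0 : 0 ≤ a) (hc : 0 ≤ c)
    (h : ∀ x ∈ s, x ⊓ c ≤ 0) : a ⊓ c = 0 := by
  refine le_antisymm ?_ (le_inf ha0 hc)
  -- `x ⊓ c ≤ 0` gives `x + c ≤ x ⊔ c`, so `a ⊔ c - c` is an upper bound of `s`; then `a + c ≤ a ⊔
  -- c`, which says `a ⊓ c ≤ 0`.
  have hle : a ≤ a ⊔ c - c := ha.2 fun x hx => by
    have h1 : x + c ≤ x ⊔ c := by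
      rw [← inf_add_sup x c]
      exact add_le_of_nonpos_left (h x hx)
    exact le_sub_iff_add_le.2 (h1.trans (sup_le_sup_right (ha.1 hx) c))
  have h2 := inf_add_sup a c
  have h3 := le_sub_iff_add_le.1 hle
  rw [← h2] at h3
  exact nonpos_of_add_le_left h3

/-- In a Dedekind complete lattice-ordered group, the component of `b` in the band generated
by `c`. -/
theorem IsDedekindComplete.exists_component (hE : IsDedekindComplete E) {b c : E} (hb : 0 ≤ b)
    (hc : 0 ≤ c) :
    ∃ p, 0 ≤ p ∧ p ≤ b ∧ (b - p) ⊓ c = 0 ∧ ∀ d, 0 ≤ d → c ⊓ d = 0 → p ⊓ d = 0 := by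
  obtain ⟨p, hp⟩ := hE (Set.range fun n : ℕ => b ⊓ n • c) (Set.range_nonempty _)
    ⟨b, by rintro _ ⟨n, rfl⟩; exact inf_le_left⟩
  have hp0 : 0 ≤ p := by
    refine le_trans ?_ (hp.1 ⟨0, rfl⟩)
    simpa using hb
  have hpb : p ≤ b := hp.2 (by rintro _ ⟨n, rfl⟩; exact inf_le_left)
  refine ⟨p, hp0, hpb, ?_, ?_⟩
  · refine le_antisymm ?_ (le_inf (sub_nonneg.2 hpb) hc)
    -- Adding `(b - p) ⊓ c` to the `n`-th term stays below the next one, so `p` absorbs it.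
    have h : p ≤ p - (b - p) ⊓ c := hp.2 (by
      rintro _ ⟨n, rfl⟩
      rw [le_sub_iff_add_le]
      refine le_trans ?_ (hp.1 ⟨n + 1, rfl⟩)
      refine le_inf ?_ ?_
      · calc b ⊓ n • c + (b - p) ⊓ c ≤ p + (b - p) := add_le_add (hp.1 ⟨n, rfl⟩) inf_le_left
          _ = b := by abel
      · rw [succ_nsmul]
        exact add_le_add inf_le_right inf_le_right)
    exact neg_nonneg.1 (by rwa [sub_eq_add_neg, le_add_iff_nonneg_right] at h)
  · intro d hd hcd
    refine hp.inf_eq_zero hp0 hd ?_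
    rintro _ ⟨n, rfl⟩
    exact (inf_le_inf_right d inf_le_right).trans (nsmul_inf_eq_zero hc hd hcd n).le

/-- In a universally complete lattice-ordered group, a set is bounded above as soon as every
positive element `y` has a multiple dominating some `z > 0` on whose support the set is
bounded. -/
theorem IsUniversallyComplete.bddAbove (hE : IsUniversallyComplete E) {A : Set E}
    (hA : ∀ y : E, 0 < y → ∃ n : ℕ, ∃ z, 0 < z ∧ z ≤ n • y ∧
      ∃ b, 0 ≤ b ∧ ∀ w ∈ A, (w - b)⁺ ⊓ z = 0) : BddAbove A := by
  let good : Set E := {c | 0 < c ∧ ∃ b, 0 ≤ b ∧ ∀ w ∈ A, (w - b)⁺ ⊓ c = 0}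
  -- A maximal disjoint set of positive elements on whose supports `A` is bounded.
  obtain ⟨C, hC⟩ := zorn_subset
    {C : Set E | C ⊆ good ∧ C.Pairwise fun x y => x ⊓ y = 0} (by
      intro K hK hchain
      refine ⟨⋃₀ K, ⟨Set.sUnion_subset fun s hs => (hK hs).1, ?_⟩,
        fun s hs => Set.subset_sUnion_of_mem hs⟩
      exact (Set.pairwise_sUnion hchain.directedOn).2 fun s hs => (hK hs).2)
  obtain ⟨hCgood, hCdisj⟩ := hC.prop
  -- Cutting the local bound `b` down to the band of `c` keeps it a bound on the support of `c` and
  -- makes the bounds for distinct members of `C` disjoint.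
  have hcomp : ∀ c : C, ∃ p, 0 ≤ p ∧ (∀ w ∈ A, (w - p)⁺ ⊓ (c : E) = 0) ∧
      ∀ d, 0 ≤ d → (c : E) ⊓ d = 0 → p ⊓ d = 0 := by
    rintro ⟨c, hc⟩
    obtain ⟨hc0, b, hb0, hb⟩ := hCgood hc
    obtain ⟨p, hp0, hpb, hpc, hpd⟩ := hE.1.exists_component hb0 hc0.le
    refine ⟨p, hp0, fun w hw => le_antisymm ?_ (le_inf (posPart_nonneg _) hc0.le), hpd⟩
    have h : (w - p)⁺ ≤ (w - b)⁺ + (b - p) := by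
      refine sup_le ?_ (add_nonneg (posPart_nonneg _) (sub_nonneg.2 hpb))
      calc w - p = (w - b) + (b - p) := by abel
        _ ≤ _ := add_le_add (le_posPart _) le_rfl
    calc (w - p)⁺ ⊓ c ≤ ((w - b)⁺ + (b - p)) ⊓ c := inf_le_inf_right c h
      _ ≤ (w - b)⁺ ⊓ c + (b - p) ⊓ c :=
        add_inf_le_of_nonneg (posPart_nonneg _) (sub_nonneg.2 hpb) hc0.le
      _ = 0 := by rw [hb w hw, hpc, add_zero]
  choose p hp0 hpA hpd using hcomp
  -- The element `0` is added in case `C` is empty.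
  obtain ⟨U, hU⟩ := hE.2 (insert 0 (Set.range p)) (Set.insert_nonempty _ _)
    (by rintro x (rfl | ⟨c, rfl⟩); exacts [le_rfl, hp0 c])
    (by
      rintro x (rfl | ⟨c, rfl⟩) y (rfl | ⟨d, rfl⟩) hxy
      · exact inf_idem 0
      · exact inf_eq_left.2 (hp0 d)
      · exact inf_eq_right.2 (hp0 c)
      · have hcd : (c : E) ≠ d := fun h => hxy (congrArg p (Subtype.ext h))
        refine hpd c _ (hp0 d) ?_
        rw [inf_comm]
        refine hpd d _ (hCgood c.2).1.le ?_
        exact hCdisj d.2 c.2 hcd.symm)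
  refine ⟨U, fun w hw => ?_⟩
  by_contra hwU
  have hg : 0 < (w - U)⁺ := by
    refine lt_of_le_of_ne (posPart_nonneg _) fun h => hwU ?_
    exact sub_nonpos.1 (posPart_eq_zero.1 h.symm)
  -- The excess `(w - U)⁺` is disjoint from all of `C`, hence so is `z`. Maximality puts `z` into
  -- `C`, so `z` is disjoint from itself.
  obtain ⟨n, z, hz, hzn, hzb⟩ := hA _ hg
  have hzC : ∀ c ∈ C, z ⊓ c = 0 := by
    intro c hc
    have hc0 := (hCgood hc).1.le
    have h1 : (w - U)⁺ ⊓ c = 0 := by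
      refine le_antisymm ?_ (le_inf hg.le hc0)
      rw [← hpA ⟨c, hc⟩ w hw]
      refine inf_le_inf_right c (posPart_mono (sub_le_sub_left (hU.1 ?_) w))
      exact Set.mem_insert_of_mem _ ⟨⟨c, hc⟩, rfl⟩
    refine le_antisymm ?_ (le_inf hz.le hc0)
    rw [← nsmul_inf_eq_zero hg.le hc0 h1 n]
    exact inf_le_inf_right c hzn
  have hins : insert z C ∈ {C : Set E | C ⊆ good ∧ C.Pairwise fun x y => x ⊓ y = 0} := by
    refine ⟨Set.insert_subset ⟨hz, hzb⟩ hCgood, ?_⟩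
    refine hCdisj.insert fun c hc _ => ⟨hzC c hc, ?_⟩
    rw [inf_comm]
    exact hzC c hc
  have hmem : z ∈ C := hC.le_of_ge hins (Set.subset_insert z C) (Set.mem_insert z C)
  have := hzC z hmem
  rw [inf_idem] at this
  exact hz.ne' this

end LatticeGroup

/-! ### Universal completeness under order isomorphisms and products -/

section Transfer

theorem IsDedekindComplete.of_orderIso {F G : Type*} [Lattice F] [Lattice G]
    (e : F ≃o G) (hF : IsDedekindComplete F) : IsDedekindComplete G := by
  intro s hs hb
  obtain ⟨a, ha⟩ := hF (e.symm '' s) (hs.image _) (e.symm.monotone.map_bddAbove hb)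
  exact ⟨e a, e.symm.isLUB_image.1 ha⟩

theorem IsLaterallyComplete.of_orderIso {F G : Type*} [AddCommGroup F] [Lattice F]
    [AddCommGroup G] [Lattice G] (e : F ≃o G) (he : e 0 = 0) (hF : IsLaterallyComplete F) :
    IsLaterallyComplete G := by
  have he' : e.symm 0 = 0 := by rw [← he, e.symm_apply_apply]
  intro s hs hpos hdisj
  obtain ⟨a, ha⟩ := hF (e.symm '' s) (hs.image _)
    (by
      rintro _ ⟨x, hx, rfl⟩
      rw [← he']
      exact e.symm.monotone (hpos x hx))
    (by
      rintro _ ⟨x, hx, rfl⟩ _ ⟨y, hy, rfl⟩ hxy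
      rw [← map_inf, hdisj hx hy fun h => hxy (congrArg e.symm h), he'])
  exact ⟨e a, e.symm.isLUB_image.1 ha⟩

theorem IsUniversallyComplete.of_orderIso {F G : Type*} [AddCommGroup F] [Lattice F]
    [AddCommGroup G] [Lattice G] (e : F ≃o G) (he : e 0 = 0) (hF : IsUniversallyComplete F) :
    IsUniversallyComplete G :=
  ⟨hF.1.of_orderIso e, hF.2.of_orderIso e he⟩

theorem isUniversallyComplete_real : IsUniversallyComplete ℝ := by
  refine ⟨fun s hs hb => ⟨_, isLUB_csSup hs hb⟩, fun s hs hpos hdisj => ?_⟩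
  refine ⟨_, isLUB_csSup hs ?_⟩
  -- Two distinct disjoint nonnegative reals include `0`, so a positive member of `s` is its
  -- greatest element.
  by_cases h : ∃ x ∈ s, 0 < x
  · obtain ⟨x, hx, hx0⟩ := h
    refine ⟨x, fun y hy => ?_⟩
    by_contra hlt
    have : x ⊓ y = 0 := hdisj hx hy (fun h => hlt h.ge)
    rw [inf_eq_left.2 (not_le.1 hlt).le] at this
    exact hx0.ne' this
  · exact ⟨0, fun y hy => not_lt.1 fun h0 => h ⟨y, hy, h0⟩⟩

variable {F G : Type*} [AddCommGroup F] [Lattice F] [AddCommGroup G] [Lattice G]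

theorem IsUniversallyComplete.prod (hF : IsUniversallyComplete F)
    (hG : IsUniversallyComplete G) : IsUniversallyComplete (F × G) := by
  refine ⟨fun s hs hb => ?_, fun s hs hpos hdisj => ?_⟩
  · obtain ⟨a, ha⟩ := hF.1 (Prod.fst '' s) (hs.image _) (monotone_fst.map_bddAbove hb)
    obtain ⟨b, hb⟩ := hG.1 (Prod.snd '' s) (hs.image _) (monotone_snd.map_bddAbove hb)
    exact ⟨(a, b), isLUB_prod.2 ⟨ha, hb⟩⟩
  · obtain ⟨a, ha⟩ := hF.2 (Prod.fst '' s) (hs.image _)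
      (by rintro _ ⟨x, hx, rfl⟩; exact (hpos x hx).1)
      (by
        rintro _ ⟨x, hx, rfl⟩ _ ⟨y, hy, rfl⟩ hxy
        exact congrArg Prod.fst (hdisj hx hy fun h => hxy (congrArg Prod.fst h)))
    obtain ⟨b, hb⟩ := hG.2 (Prod.snd '' s) (hs.image _)
      (by rintro _ ⟨x, hx, rfl⟩; exact (hpos x hx).2)
      (by
        rintro _ ⟨x, hx, rfl⟩ _ ⟨y, hy, rfl⟩ hxy
        exact congrArg Prod.snd (hdisj hx hy fun h => hxy (congrArg Prod.snd h)))
    exact ⟨(a, b), isLUB_prod.2 ⟨ha, hb⟩⟩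

/-- A set `s` embeds as `s × {0}`, and the first coordinate of a supremum there is a supremum of
`s`. -/
theorem IsUniversallyComplete.fst (h : IsUniversallyComplete (F × G)) :
    IsUniversallyComplete F := by
  have key : ∀ s : Set F, (∃ a, IsLUB ((fun x : F => (x, (0 : G))) '' s) a) →
      ∃ a, IsLUB s a := by
    rintro s ⟨a, ha⟩
    refine ⟨a.1, ?_⟩
    have := (isLUB_prod.1 ha).1
    rwa [Set.image_image, Set.image_id'] at this
  refine ⟨fun s hs ⟨b, hb⟩ => key s (h.1 _ (hs.image _) ⟨(b, 0), ?_⟩),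
    fun s hs hpos hdisj => key s (h.2 _ (hs.image _) ?_ ?_)⟩
  · rintro _ ⟨x, hx, rfl⟩
    exact ⟨hb hx, le_rfl⟩
  · rintro _ ⟨x, hx, rfl⟩
    exact ⟨hpos x hx, le_rfl⟩
  · rintro _ ⟨x, hx, rfl⟩ _ ⟨y, hy, rfl⟩ hxy
    exact Prod.ext (hdisj hx hy fun h => hxy (by rw [h])) (inf_idem 0)

end Transfer

/-! ### Units of truncations and the role of `(τ₃)` -/

namespace Truncation

variable {E : Type*} [AddCommGroup E] [Lattice E] [IsOrderedAddMonoid E] (T : Truncation E)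

theorem bddAbove_fixedPoints (hE : IsUniversallyComplete E) (hT : T.IsArchimedean) :
    BddAbove {w : E | 0 ≤ w ∧ T.toFun w = w} := by
  refine hE.bddAbove fun y hy => ?_
  obtain ⟨n, hn⟩ : ∃ n : ℕ, T.toFun (n • y) ≠ n • y := by
    by_contra! h
    exact hy.ne' (hT y hy.le h)
  have hny : 0 ≤ n • y := nsmul_nonneg hy.le n
  have ht0 := T.map_nonneg _ hny
  have hle := T.le_self _ hny
  -- With `t` the truncation of `n y`, `(w - t)⁺ ⊓ (n y - t) = (w ⊔ t) ⊓ n y - t`. This is at most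
  -- `0` by `(τ₁)`, because `w ⊔ t` is a fixed point.
  refine ⟨n, n • y - T.toFun (n • y), sub_pos.2 (lt_of_le_of_ne hle hn),
    sub_le_self _ ht0, T.toFun (n • y), ht0, ?_⟩
  rintro w ⟨hw, hTw⟩
  have h := T.inf_le (n • y) (w ⊔ T.toFun (n • y)) hny (hw.trans le_sup_left)
  rw [T.map_sup hw ht0 hTw (T.map_map hny)] at h
  refine le_antisymm ?_ (le_inf (posPart_nonneg _) (sub_nonneg.2 hle))
  have hpos : (w - T.toFun (n • y))⁺ = w ⊔ T.toFun (n • y) - T.toFun (n • y) := by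
    rw [posPart_def, sup_sub, sub_self]
  rw [hpos, ← inf_sub, inf_comm]
  exact sub_nonpos.2 h

/-- The unit `u` is the supremum of the positive fixed points. Truncations are fixed points, so
`T.toFun x ≤ x ⊓ u`; conversely `x ⊓ w ≤ T.toFun x` for each fixed `w`, and meets distribute over
suprema. -/
theorem isUnital_of_isArchimedean (hE : IsUniversallyComplete E) (hT : T.IsArchimedean) :
    T.IsUnital := by
  obtain ⟨u, hu⟩ := hE.1 {w : E | 0 ≤ w ∧ T.toFun w = w} ⟨0, le_rfl, T.map_zero⟩
    (T.bddAbove_fixedPoints hE hT)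
  refine ⟨u, hu.1 ⟨le_rfl, T.map_zero⟩, fun x hx => le_antisymm
    (le_inf (T.le_self x hx) (hu.1 ⟨T.map_nonneg x hx, T.map_map hx⟩)) ?_⟩
  -- The distributive law enters through `x ⊓ w + x ⊔ w = x + w`, which turns the bound on `x ⊓ w`
  -- into one on `w`.
  have h : u ≤ T.toFun x + x ⊔ u - x := hu.2 (by
    rintro w ⟨hw, hTw⟩
    have h1 := T.inf_le x w hx hw
    rw [hTw] at h1
    rw [le_sub_iff_add_le, add_comm, ← inf_add_sup x w]
    exact add_le_add h1 (sup_le_sup_left (hu.1 ⟨hw, hTw⟩) x))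
  rw [le_sub_iff_add_le, add_comm, ← inf_add_sup x u] at h
  exact le_of_add_le_add_right h

variable {T} [Module ℝ E] [IsOrderedModule ℝ E]

/-- The unit is the largest positive fixed point, so it can replace any witness `w` in `isPos_iff`.
-/
theorem Unitization.isPos_iff_of_unit {u : E} (hu0 : 0 ≤ u)
    (hu : ∀ x, 0 ≤ x → T.toFun x = x ⊓ u) (p : T.Unitization) :
    p.IsPos ↔ 0 ≤ p.2 ∧ 0 ≤ p.1 + p.2 • u := by
  rw [isPos_iff]
  refine and_congr_right fun hp => ⟨?_, fun h => ⟨u, hu0, ?_, h⟩⟩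
  · rintro ⟨w, hw, hTw, h⟩
    have hwu : w ≤ u := by
      rw [hu w hw] at hTw
      exact inf_eq_left.1 hTw
    exact h.trans (add_le_add le_rfl (smul_le_smul_of_nonneg_left hwu hp))
  · rw [hu u hu0, inf_idem]

/-- The unitization of a truncation with unit `u` is the product of `E` and `ℝ`. -/
def Unitization.orderIsoProd {u : E} (hu0 : 0 ≤ u) (hu : ∀ x, 0 ≤ x → T.toFun x = x ⊓ u) :
    T.Unitization ≃o E × ℝ where
  toFun p := (p.1 + p.2 • u, p.2)
  invFun q := ((q.1 - q.2 • u, q.2) : E × ℝ)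
  left_inv p := Prod.ext (add_sub_cancel_right p.1 (p.2 • u)) rfl
  right_inv q := Prod.ext (sub_add_cancel q.1 (q.2 • u)) rfl
  map_rel_iff' {p q} := by
    rw [le_iff, isPos_iff_of_unit hu0 hu]
    change (p.1 + p.2 • u ≤ q.1 + q.2 • u ∧ p.2 ≤ q.2) ↔
      0 ≤ q.2 - p.2 ∧ 0 ≤ q.1 - p.1 + (q.2 - p.2) • u
    rw [sub_nonneg, and_comm, ← sub_nonneg (a := q.1 + q.2 • u), sub_smul,
      add_sub_add_comm]

theorem IsUnital.isUniversallyComplete_unitization_iff (h : T.IsUnital) :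
    IsUniversallyComplete T.Unitization ↔ IsUniversallyComplete E := by
  obtain ⟨u, hu0, hu⟩ := h
  let e := Unitization.orderIsoProd hu0 hu
  have he : e 0 = 0 := by
    change ((0 : E) + (0 : ℝ) • u, (0 : ℝ)) = 0
    rw [zero_smul, add_zero]
    rfl
  refine ⟨fun hU => (hU.of_orderIso e he).fst, fun hE =>
    (hE.prod isUniversallyComplete_real).of_orderIso e.symm ?_⟩
  rw [← he, e.symm_apply_apply]

/-- This is the usual proof that Dedekind completeness implies the Archimedean property, with `1` as
the bound of the multiples of `x`. -/
theorem isArchimedean_of_isDedekindComplete_unitization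
    (h : IsDedekindComplete T.Unitization) : T.IsArchimedean := by
  intro x hx hfix
  obtain ⟨⟨y, r⟩, hs⟩ := h (Set.range fun n : ℕ => ((n • x, 0) : E × ℝ))
    (Set.range_nonempty _) ⟨((0, 1) : E × ℝ), by
      rintro _ ⟨n, rfl⟩
      -- The fixed point `n x` is its own witness for `0 ≤ 1 - n x`.
      refine (Unitization.isPos_iff _).2 ⟨?_, n • x, nsmul_nonneg hx n, hfix n, ?_⟩
      · change (0 : ℝ) ≤ 1 - 0
        norm_num
      · change 0 ≤ 0 - n • x + ((1 : ℝ) - 0) • (n • x)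
        rw [sub_zero, one_smul, zero_sub, neg_add_cancel]⟩
  -- If `s = y + r` is the supremum, `s - x` is again an upper bound, as `(n + 1) x ≤ s`. Hence `s ≤
  -- s - x`.
  have hle : Unitization.IsPos (T := T) (((y - x, r) : E × ℝ) - ((y, r) : E × ℝ)) := by
    refine hs.2 ?_
    rintro _ ⟨n, rfl⟩
    have h1 : Unitization.IsPos (T := T) (((y, r) : E × ℝ) - (((n + 1) • x, 0) : E × ℝ)) :=
      hs.1 ⟨n + 1, rfl⟩
    have h2 : (((y - x, r) : E × ℝ) - ((n • x, 0) : E × ℝ)) =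
        ((y, r) : E × ℝ) - (((n + 1) • x, 0) : E × ℝ) := by
      rw [Prod.mk_sub_mk, Prod.mk_sub_mk, succ_nsmul]
      congr 1
      abel
    change Unitization.IsPos (T := T) (((y - x, r) : E × ℝ) - ((n • x, 0) : E × ℝ))
    rwa [h2]
  obtain ⟨-, w, -, -, hw⟩ := (Unitization.isPos_iff _).1 hle
  change 0 ≤ y - x - y + (r - r) • w at hw
  rw [sub_self, zero_smul, add_zero, sub_sub_cancel_left] at hw
  exact le_antisymm (neg_nonneg.1 hw) hx

end Truncation

theorem theorem7p2 {E : Type*} [AddCommGroup E] [Lattice E] [IsOrderedAddMonoid E]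
    [Module ℝ E] [IsOrderedModule ℝ E] (T : Truncation E) :
    (IsUniversallyComplete E → (IsUniversallyComplete T.Unitization ↔ T.IsArchimedean)) ∧
    (IsUniversallyComplete T.Unitization → (IsUniversallyComplete E ↔ T.IsUnital)) :=
  ⟨fun hE => ⟨fun hU => Truncation.isArchimedean_of_isDedekindComplete_unitization hU.1,
      fun hT => (T.isUnital_of_isArchimedean hE hT).isUniversallyComplete_unitization_iff.2 hE⟩,
    fun hU => ⟨fun hE => T.isUnital_of_isArchimedean hE
        (Truncation.isArchimedean_of_isDedekindComplete_unitization hU.1),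
      fun hT => hT.isUniversallyComplete_unitization_iff.1 hU⟩⟩
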